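/- Let $c>0$ be a real constant and let $r\ge 2$ be a fixed integer. For $n\ge c$ let $G_{n,p}$ be the binomial random graph on $n$ vertices in which each pair of vertices is joined by an edge independently with probability $p=c/n$. For a graph $G$, let $G^r$ be the graph on the same vertex set in which two distinct vertices are adjacent if and only if their distance in $G$ is at most $r$, and let $\Delta(G^r)$ be its maximum degree. Let $\log_{(k)}$ denote the $k$-fold iterated natural logarithm, so that for example $\log_{(3)} n=\log\log\log n$. Then with high probability $$\Delta(G_{n,p}^r)\sim \frac{\log n}{\log_{(r+1)} n},$$ that is, for every $\varepsilon>0$, $$\lim_{n\to\infty}\mathbb{P}\left[(1-\varepsilon)\frac{\log n}{\log_{(r+1)} n}\le \Delta(G_{n,p}^r)\le (1+\varepsilon)\frac{\log n}{\log_{(r+1)} n}\right]=1.$$ -/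

import Mathlib

open Filter Topology

namespace SimpleGraph

/-- The `r`-th power of a graph: two distinct vertices are adjacent if and only if their distance
in `G` is at most `r` (the distance is `⊤` between different components). -/
def power {V : Type*} (G : SimpleGraph V) (r : ℕ) : SimpleGraph V where
  Adj u v := u ≠ v ∧ G.edist u v ≤ (r : ℕ∞)
  symm := ⟨fun u v h => ⟨h.1.symm, by rw [SimpleGraph.edist_comm]; exact h.2⟩⟩
  loopless := ⟨fun _ h => h.1 rfl⟩

noncomputable instance power.instDecidableRelAdj {V : Type*} (G : SimpleGraph V) (r : ℕ) :
    DecidableRel (G.power r).Adj :=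
  Classical.decRel _

end SimpleGraph

/-- The `k`-fold iterated natural logarithm `log log ⋯ log x`. -/
noncomputable def iteratedLog (k : ℕ) (x : ℝ) : ℝ :=
  Real.log^[k] x

/-- Asymptotic equality with high probability: `X n` is a real random variable on the probability
space `(Ω n, μ n)`, and for every fixed `ε > 0` the probability of
`(1 - ε) f n ≤ X n ≤ (1 + ε) f n` tends to `1`. -/
def AsympEqWHP {Ω : ℕ → Type*} [∀ n, MeasurableSpace (Ω n)]
    (μ : ∀ n, MeasureTheory.Measure (Ω n)) (X : ∀ n, Ω n → ℝ) (f : ℕ → ℝ) : Prop :=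
  ∀ ε : ℝ, 0 < ε →
    Tendsto (fun n => μ n {ω | (1 - ε) * f n ≤ X n ω ∧ X n ω ≤ (1 + ε) * f n}) atTop (𝓝 1)

/-! A vertex has degree one less than the size of its ball of radius `r` in the base graph, so the
theorem concerns the largest ball. Put `L = log n`; the target is `L / log^[r] L`.

Upper bound: let `E_k(U)` be the expectation of `exp (t * |ball of radius k around U|)`. Each vertex
of the first layer outside `U` has a parent in `U`; a union bound over the layer and the parents
gives `E_k(U) ≤ exp (T_k * |U|)` with `T_0 = t` and `T_{k+1} = T_k + c * exp T_k`
(`sum_exp_ballIn_le`). Each step is roughly one exponentiation, so for `t = η * log^[r] L` with `η <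
1` the exponent `T_r` is still `o(L)`. With `η` close to 1, Markov's inequality makes a ball larger
than `(1 + ε) L / log^[r] L` less likely than `n ^ (-1 - ε/4)`, and a union bound over the vertices
finishes.

Lower bound: look for a vertex whose successive layers have sizes `a 0 = 1, a 1, …, a r`. Up to
lower-order terms, passing from `a i` to `a (i+1)` costs a factor `exp (-a (i+1) * log (a (i+1) / a
i))`. Take `a i = L / (log^[i] L * log^[i+1] L)` for `0 < i < r` and `a r = (1 - ε) L / log^[r] L`.
Then `a (i+1) / a i ≤ 2 * log^[i] L`, so every layer but the last costs only `o(L)` in the exponent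
and the last costs `(1 - ε) L`. One attempt thus succeeds with probability at least `n ^ (-1 +
ε/2)`. A failed attempt uses up at most `a r ≤ L` vertices and reveals only pairs meeting them, so
there is room for about `n / L` independent attempts, and one succeeds with high probability
(`binomialRandom_real_forall_card_ballIn_le_le`, `prod_le_binomialRandom_real_hasLayers`). -/

open MeasureTheory ProbabilityTheory unitInterval

/-! ### Independence and edge probabilities in the binomial random graph -/

namespace SimpleGraph

variable {V : Type*}

theorem measurableSet_of_finite [Fintype V] (A : Set (SimpleGraph V)) : MeasurableSet A := by
  have h : A = edgeSet ⁻¹' (edgeSet '' A) := (Set.preimage_image_eq A edgeSet_injective).symm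
  rw [h]
  exact measurable_edgeSet (Set.toFinite _).measurableSet

/-- Membership in `A` depends only on which of the pairs in `S` are edges. -/
def DeterminedBy (S : Set (Sym2 V)) (A : Set (SimpleGraph V)) : Prop :=
  ∀ G H : SimpleGraph V, (∀ e ∈ S, e ∈ G.edgeSet ↔ e ∈ H.edgeSet) → G ∈ A → H ∈ A

/-- The law of the indicator of a pair being an edge, including the diagonal pairs. -/
noncomputable def pairLaw (p : I) (e : Sym2 V) : Measure Prop :=
  toNNReal p • Measure.dirac (e ∈ (Sym2.diagSetᶜ : Set (Sym2 V))) +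
    toNNReal (σ p) • Measure.dirac False

instance (p : I) (e : Sym2 V) : IsProbabilityMeasure (pairLaw p e) := by
  unfold pairLaw; infer_instance

theorem binomialRandom_eq_map_pi [Fintype V] (p : I) :
    binomialRandom V p = Measure.map (fun f : Sym2 V → Prop => fromEdgeSet {e | f e})
      (Measure.infinitePi (pairLaw (V := V) p)) := by
  rw [binomialRandom_eq_map, setBernoulli_eq_map, Measure.map_map]
  · rfl
  · exact measurable_fromEdgeSet
  · exact Measurable.of_discrete

/-- The edge indicators are independent coordinates of a product measure, and an event determined by
`S` is pulled back from the coordinates in `S`. All independence used later comes from here. -/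
theorem binomialRandom_real_inter [Fintype V] {p : I} {S T : Finset (Sym2 V)}
    {A B : Set (SimpleGraph V)}
    (hST : Disjoint S T) (hA : DeterminedBy S A) (hB : DeterminedBy T B) :
    (binomialRandom V p).real (A ∩ B) =
      (binomialRandom V p).real A * (binomialRandom V p).real B := by
  set ν := Measure.infinitePi (pairLaw (V := V) p) with hν
  set g := fun f : Sym2 V → Prop => fromEdgeSet {e | f e} with hg
  have hgm : Measurable g := measurable_fromEdgeSet.comp Measurable.of_discrete
  have hind : iIndepFun (fun (e : Sym2 V) (f : Sym2 V → Prop) => f e) ν :=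
    iIndepFun_infinitePi (X := fun _ x => x) (fun _ => measurable_id)
  have h2 := hind.indepFun_finset S T hST (fun e => measurable_pi_apply e)
  have key : ∀ (S : Finset (Sym2 V)) (A : Set (SimpleGraph V)), DeterminedBy S A →
      ∃ A' : Set (S → Prop), g ⁻¹' A = (fun f (i : S) => f i) ⁻¹' A' := by
    intro S A hA
    refine ⟨(fun f (i : S) => f i) '' (g ⁻¹' A), Set.Subset.antisymm (Set.subset_preimage_image _ _)
      ?_⟩
    rintro f ⟨f', hf', hff'⟩
    refine hA (g f') (g f) (fun e he => ?_) hf'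
    have : f' e = f e := congrFun hff' ⟨e, he⟩
    simp [hg, this]
  obtain ⟨A', hA'⟩ := key S A hA
  obtain ⟨B', hB'⟩ := key T B hB
  have h3 := h2.measure_inter_preimage_eq_mul A' B' (Set.toFinite _).measurableSet
    (Set.toFinite _).measurableSet
  rw [binomialRandom_eq_map_pi, measureReal_def, measureReal_def, measureReal_def,
    Measure.map_apply hgm (measurableSet_of_finite _),
    Measure.map_apply hgm (measurableSet_of_finite _),
    Measure.map_apply hgm (measurableSet_of_finite _), ← ENNReal.toReal_mul, Set.preimage_inter,
    hA', hB', h3]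

theorem binomialRandom_real_mem_edgeSet [Fintype V] (p : I) {e : Sym2 V} (he : ¬ e.IsDiag) :
    (binomialRandom V p).real {G | e ∈ G.edgeSet} = p := by
  rw [binomialRandom_eq_map_pi, measureReal_def,
    Measure.map_apply (f := fun f : Sym2 V → Prop => fromEdgeSet {e | f e})
      (measurable_fromEdgeSet.comp Measurable.of_discrete)
      (measurableSet_of_finite _)]
  have h : (fun f : Sym2 V → Prop => fromEdgeSet {e | f e}) ⁻¹' {G | e ∈ G.edgeSet} =
      (fun f : Sym2 V → Prop => f e) ⁻¹' {True} := by
    ext f; simp [he]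
  rw [h, ← Measure.map_apply (measurable_pi_apply e) (Set.toFinite _).measurableSet,
    Measure.infinitePi_map_eval]
  simp [pairLaw, he]

theorem determinedBy_subset_edgeSet (S : Finset (Sym2 V)) :
    DeterminedBy (S : Set (Sym2 V)) {G : SimpleGraph V | ↑S ⊆ G.edgeSet} :=
  fun _ _ h hG e he => (h e he).1 (hG he)

theorem determinedBy_disjoint_edgeSet (S : Finset (Sym2 V)) :
    DeterminedBy (S : Set (Sym2 V)) {G : SimpleGraph V | Disjoint (↑S) G.edgeSet} := by
  intro G H h hG
  simp only [Set.mem_ofPred_eq, Set.disjoint_left] at hG ⊢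
  exact fun e he hH => hG he ((h e he).2 hH)

theorem binomialRandom_real_subset_edgeSet [Fintype V] [DecidableEq V] (p : I)
    {S : Finset (Sym2 V)}
    (hS : ∀ e ∈ S, ¬ e.IsDiag) :
    (binomialRandom V p).real {G | ↑S ⊆ G.edgeSet} = (p : ℝ) ^ S.card := by
  induction S using Finset.induction_on with
  | empty => simp
  | insert e S heS ih =>
    have h : {G : SimpleGraph V | ↑(insert e S) ⊆ G.edgeSet} =
        {G | e ∈ G.edgeSet} ∩ {G | ↑S ⊆ G.edgeSet} := by
      ext G; simp [Set.insert_subset_iff]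
    rw [h, binomialRandom_real_inter (S := {e}) (T := S) (by simpa using heS) ?_
      (determinedBy_subset_edgeSet S), binomialRandom_real_mem_edgeSet p (hS e (by simp)),
      ih fun f hf => hS f (by simp [hf]), Finset.card_insert_of_notMem heS]
    · ring
    · intro G H h
      simpa using (h e (by simp)).1

theorem binomialRandom_real_disjoint_edgeSet [Fintype V] [DecidableEq V] (p : I)
    {S : Finset (Sym2 V)}
    (hS : ∀ e ∈ S, ¬ e.IsDiag) :
    (binomialRandom V p).real {G | Disjoint (↑S) G.edgeSet} = (1 - p : ℝ) ^ S.card := by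
  induction S using Finset.induction_on with
  | empty => simp
  | insert e S heS ih =>
    have h : {G : SimpleGraph V | Disjoint (↑(insert e S)) G.edgeSet} =
        {G | e ∈ G.edgeSet}ᶜ ∩ {G | Disjoint (↑S) G.edgeSet} := by
      ext G; simp [Set.disjoint_insert_left]
    rw [h, binomialRandom_real_inter (S := {e}) (T := S) (by simpa using heS) ?_
      (determinedBy_disjoint_edgeSet S), probReal_compl_eq_one_sub (measurableSet_of_finite _),
      binomialRandom_real_mem_edgeSet p (hS e (by simp)),
      ih fun f hf => hS f (by simp [hf]), Finset.card_insert_of_notMem heS]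
    · ring
    · intro G H h
      simpa using (h e (by simp)).2.mt

theorem binomialRandom_real_eq_sum [Fintype V] (p : I) (A : Set (SimpleGraph V))
    [DecidablePred (· ∈ A)] [Fintype (SimpleGraph V)] :
    (binomialRandom V p).real A =
      ∑ G : SimpleGraph V, if G ∈ A then (binomialRandom V p).real {G} else 0 := by
  have : MeasurableSingletonClass (SimpleGraph V) := ⟨fun _ => measurableSet_of_finite _⟩
  rw [← Finset.sum_filter, sum_measureReal_singleton]
  congr 1
  ext G; simp

/-! ### Balls explored inside a vertex set -/

open Classical in
/-- The vertices of `U` with a neighbour in `A`. -/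
noncomputable def neighborsIn (G : SimpleGraph V) (U A : Finset V) : Finset V :=
  U.filter fun w => ∃ a ∈ A, G.Adj a w

theorem mem_neighborsIn {G : SimpleGraph V} {U A : Finset V} {w : V} :
    w ∈ G.neighborsIn U A ↔ w ∈ U ∧ ∃ a ∈ A, G.Adj a w := by
  simp [neighborsIn]

theorem neighborsIn_subset (G : SimpleGraph V) (U A : Finset V) : G.neighborsIn U A ⊆ U :=
  fun _ h => (mem_neighborsIn.1 h).1

theorem neighborsIn_mono (G : SimpleGraph V) {U U' A A' : Finset V} (hU : U ⊆ U') (hA : A ⊆ A') :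
    G.neighborsIn U A ⊆ G.neighborsIn U' A' := by
  intro w hw
  obtain ⟨h1, a, ha, h2⟩ := mem_neighborsIn.1 hw
  exact mem_neighborsIn.2 ⟨hU h1, a, hA ha, h2⟩

/-- The vertices reached from `A` by at most `k` steps, all of which end in `U`. -/
noncomputable def ballIn [DecidableEq V] (G : SimpleGraph V) (U : Finset V) :
    ℕ → Finset V → Finset V
  | 0, A => A
  | k + 1, A => ballIn G U k (A ∪ G.neighborsIn U A)

theorem subset_ballIn [DecidableEq V] (G : SimpleGraph V) (U : Finset V) (k : ℕ) (A : Finset V) :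
    A ⊆ G.ballIn U k A := by
  induction k generalizing A with
  | zero => exact subset_rfl
  | succ k ih => exact Finset.subset_union_left.trans (ih _)

theorem ballIn_subset [DecidableEq V] (G : SimpleGraph V) {U : Finset V} (k : ℕ) {A : Finset V}
    (hA : A ⊆ U) : G.ballIn U k A ⊆ U := by
  induction k generalizing A with
  | zero => exact hA
  | succ k ih => exact ih (Finset.union_subset hA (G.neighborsIn_subset U A))

theorem ballIn_mono [DecidableEq V] (G : SimpleGraph V) {U U' A A' : Finset V} (hU : U ⊆ U')
    (hA : A ⊆ A') (k : ℕ) : G.ballIn U k A ⊆ G.ballIn U' k A' := by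
  induction k generalizing A A' with
  | zero => exact hA
  | succ k ih => exact ih (Finset.union_subset_union hA (G.neighborsIn_mono hU hA))

/-- The exploration queries only pairs with one end in the resulting ball and the other in `U`. This
locality is what makes consecutive explorations independent. -/
theorem ballIn_congr [DecidableEq V] {G H : SimpleGraph V} {U A : Finset V} {k : ℕ}
    (h : ∀ x ∈ G.ballIn U k A, ∀ y ∈ U, G.Adj x y ↔ H.Adj x y) :
    G.ballIn U k A = H.ballIn U k A := by
  induction k generalizing A with
  | zero => rfl
  | succ k ih =>
    have h1 : G.neighborsIn U A = H.neighborsIn U A := by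
      ext w
      simp only [mem_neighborsIn]
      refine and_congr_right fun hw => exists_congr fun a => and_congr_right fun ha => ?_
      exact h a (G.subset_ballIn U (k + 1) A ha) w hw
    have h2 := ih (A := A ∪ G.neighborsIn U A) h
    simp only [ballIn]
    rw [h2, h1]

theorem mem_ballIn_univ [Fintype V] [DecidableEq V] {G : SimpleGraph V} {k : ℕ} {A : Finset V}
    {w : V} : w ∈ G.ballIn Finset.univ k A ↔ ∃ a ∈ A, G.edist a w ≤ (k : ℕ∞) := by
  induction k generalizing A with
  | zero => simp [ballIn]
  | succ k ih =>
    simp only [ballIn]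
    rw [ih]
    constructor
    · rintro ⟨b, hb, hbw⟩
      rcases Finset.mem_union.1 hb with hb | hb
      · exact ⟨b, hb, hbw.trans (by exact_mod_cast k.le_succ)⟩
      · obtain ⟨-, a, ha, hab⟩ := mem_neighborsIn.1 hb
        refine ⟨a, ha, (SimpleGraph.edist_triangle (v := b)).trans ?_⟩
        rw [SimpleGraph.edist_eq_one_iff_adj.2 hab]
        push_cast
        rw [add_comm]
        gcongr
    · rintro ⟨a, ha, haw⟩
      have hne : G.edist a w ≠ ⊤ := ne_top_of_le_ne_top (by simp) haw
      obtain ⟨q, hq⟩ := SimpleGraph.exists_walk_of_edist_ne_top hne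
      rw [← hq] at haw
      cases q with
      | nil => exact ⟨w, Finset.mem_union_left _ ha, by simp⟩
      | @cons _ b _ hab q =>
        refine ⟨b, Finset.mem_union_right _ (mem_neighborsIn.2 ⟨by simp, a, ha, hab⟩), ?_⟩
        refine (SimpleGraph.edist_le q).trans ?_
        have : q.length + 1 ≤ k + 1 := by exact_mod_cast haw
        exact_mod_cast (by omega : q.length ≤ k)

theorem card_ballIn_univ [Fintype V] [DecidableEq V] (G : SimpleGraph V) (r : ℕ) (v : V) :
    (G.ballIn Finset.univ r {v}).card = (G.power r).degree v + 1 := by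
  have h : G.ballIn Finset.univ r {v} = insert v ((G.power r).neighborFinset v) := by
    ext w
    rw [mem_ballIn_univ]
    by_cases hw : w = v
    · simp [hw]
    · rw [Finset.mem_insert, mem_neighborFinset]
      simp [hw, power, Ne.symm hw]
  rw [h, Finset.card_insert_of_notMem (by simp), card_neighborFinset_eq_degree]

/-! ### Upper tail: exponential moments of ball sizes -/

/-- `growthExponent y t k` is the exponent obtained from `t` by `k` steps `x ↦ x + y * exp x`. -/
noncomputable def growthExponent (y t : ℝ) : ℕ → ℝ
  | 0 => t
  | k + 1 => growthExponent y t k + y * Real.exp (growthExponent y t k)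

/-- The edges joining each vertex of `A` to its image. -/
def parentEdges [DecidableEq V] (A : Finset V) (f : ∀ a ∈ A, V) : Finset (Sym2 V) :=
  A.attach.image fun a => s(f a.1 a.2, a.1)

theorem card_parentEdges [DecidableEq V] {A U : Finset V} (hAU : Disjoint U A)
    {f : ∀ a ∈ A, V} (hf : ∀ a ha, f a ha ∈ U) : (parentEdges A f).card = A.card := by
  rw [parentEdges, Finset.card_image_of_injOn, Finset.card_attach]
  rintro ⟨a, ha⟩ - ⟨b, hb⟩ - hab
  simp only [Sym2.eq_iff] at hab
  rcases hab with hab | hab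
  · exact Subtype.ext hab.2
  · exact absurd ha (Finset.disjoint_left.1 hAU (hab.2 ▸ hf b hb))

theorem parentEdges_not_isDiag [DecidableEq V] {A U : Finset V} (hAU : Disjoint U A)
    {f : ∀ a ∈ A, V} (hf : ∀ a ha, f a ha ∈ U) {e : Sym2 V} (he : e ∈ parentEdges A f) :
    ¬ e.IsDiag := by
  simp only [parentEdges, Finset.mem_image, Finset.mem_attach, true_and, Subtype.exists] at he
  obtain ⟨a, ha, rfl⟩ := he
  rw [Sym2.mk_isDiag_iff]
  intro h
  exact Finset.disjoint_left.1 hAU (hf a ha) (h.symm ▸ ha)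

open Classical in
/-- `exp (t * |ball|)` for the ball of radius `k` around `U`, on the event that all pairs in `S`
are edges. -/
noncomputable def expBallWeight [Fintype V] [DecidableEq V] (G : SimpleGraph V) (t : ℝ) (k : ℕ)
    (U : Finset V) (S : Finset (Sym2 V)) : ℝ :=
  if (S : Set (Sym2 V)) ⊆ G.edgeSet then Real.exp (t * (G.ballIn Finset.univ k U).card) else 0

theorem expBallWeight_nonneg [Fintype V] [DecidableEq V] (G : SimpleGraph V) (t : ℝ) (k : ℕ)
    (U : Finset V) (S : Finset (Sym2 V)) : 0 ≤ G.expBallWeight t k U S := by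
  unfold expBallWeight
  split_ifs <;> positivity

theorem mem_parentEdges [DecidableEq V] {A : Finset V} {f : ∀ a ∈ A, V} {e : Sym2 V} :
    e ∈ parentEdges A f ↔ ∃ a, ∃ ha : a ∈ A, s(f a ha, a) = e := by
  simp [parentEdges]

/-- The true first layer outside `U`, with any choice of parents, gives a term equal to the left
side; all other terms are nonnegative. Recording the parent edges in `S` replaces conditioning on
the layer. -/
theorem expBallWeight_succ_le [Fintype V] [DecidableEq V] (G : SimpleGraph V) (t : ℝ) (k : ℕ)
    (U : Finset V) (S : Finset (Sym2 V)) :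
    G.expBallWeight t (k + 1) U S ≤ ∑ A ∈ Uᶜ.powerset, ∑ f ∈ A.pi fun _ => U,
      G.expBallWeight t k (U ∪ A) (S ∪ parentEdges A f) := by
  by_cases hG : (S : Set (Sym2 V)) ⊆ G.edgeSet
  swap
  · rw [expBallWeight, if_neg hG]
    exact Finset.sum_nonneg fun A _ => Finset.sum_nonneg fun f _ => expBallWeight_nonneg _ _ _ _ _
  have hex : ∀ a ∈ G.neighborsIn Uᶜ U, ∃ b ∈ U, G.Adj b a := fun a ha => (mem_neighborsIn.1 ha).2
  choose f hfU hfadj using hex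
  have hball : G.ballIn Finset.univ (k + 1) U =
      G.ballIn Finset.univ k (U ∪ G.neighborsIn Uᶜ U) := by
    have : U ∪ G.neighborsIn Finset.univ U = U ∪ G.neighborsIn Uᶜ U := by
      ext w
      simp only [Finset.mem_union, mem_neighborsIn, Finset.mem_univ, Finset.mem_compl]
      tauto
    simp only [ballIn, this]
  have hsub : ((S ∪ parentEdges (G.neighborsIn Uᶜ U) f : Finset (Sym2 V)) : Set (Sym2 V)) ⊆
      G.edgeSet := by
    intro e he
    rcases Finset.mem_union.1 (Finset.mem_coe.1 he) with he | he
    · exact hG he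
    · obtain ⟨a, ha, rfl⟩ := mem_parentEdges.1 he
      exact hfadj a ha
  have heq : G.expBallWeight t (k + 1) U S = G.expBallWeight t k (U ∪ G.neighborsIn Uᶜ U)
      (S ∪ parentEdges (G.neighborsIn Uᶜ U) f) := by
    rw [expBallWeight, expBallWeight, if_pos hG, if_pos hsub, hball]
  rw [heq]
  refine le_trans ?_ (Finset.single_le_sum
    (f := fun A => ∑ f ∈ A.pi fun _ => U, G.expBallWeight t k (U ∪ A) (S ∪ parentEdges A f))
    (fun A _ => Finset.sum_nonneg fun f _ => expBallWeight_nonneg _ _ _ _ _)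
    (Finset.mem_powerset.2 (G.neighborsIn_subset Uᶜ U)))
  exact Finset.single_le_sum (f := fun f => G.expBallWeight t k (U ∪ G.neighborsIn Uᶜ U)
      (S ∪ parentEdges (G.neighborsIn Uᶜ U) f))
    (fun f _ => expBallWeight_nonneg _ _ _ _ _) (Finset.mem_pi.2 hfU)

/-- Radius is traded for prescribed edges until the ball is `U` itself and only the probability `p ^
S.card` remains. The hypothesis that `S` lives inside `U` ensures that newly prescribed edges are
new. -/
theorem sum_exp_ballIn_le [Fintype V] [DecidableEq V] (p : I) (t : ℝ) (k : ℕ) (U : Finset V)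
    (S : Finset (Sym2 V)) (hS : ∀ e ∈ S, ¬ e.IsDiag) (hSU : ∀ e ∈ S, ∀ x ∈ e, x ∈ U) :
    ∑ G : SimpleGraph V, (binomialRandom V p).real {G} * G.expBallWeight t k U S ≤
      (p : ℝ) ^ S.card *
        Real.exp (growthExponent (Fintype.card V * p) t k * U.card) := by
  have hp0 : 0 ≤ (p : ℝ) := p.2.1
  induction k generalizing U S with
  | zero =>
    classical
    rw [← binomialRandom_real_subset_edgeSet p hS, binomialRandom_real_eq_sum, Finset.sum_mul]
    refine Finset.sum_le_sum fun G _ => ?_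
    by_cases h : (S : Set (Sym2 V)) ⊆ G.edgeSet <;>
      simp [expBallWeight, ballIn, growthExponent, h]
  | succ k ih =>
    set T := growthExponent (Fintype.card V * p) t k with hT
    calc _ ≤ ∑ G : SimpleGraph V, ∑ A ∈ Uᶜ.powerset, ∑ f ∈ A.pi fun _ => U,
          (binomialRandom V p).real {G} * G.expBallWeight t k (U ∪ A) (S ∪ parentEdges A f) :=
          by
          refine Finset.sum_le_sum fun G _ => (mul_le_mul_of_nonneg_left
            (G.expBallWeight_succ_le t k U S) measureReal_nonneg).trans (le_of_eq ?_)
          simp only [Finset.mul_sum]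
      _ = ∑ A ∈ Uᶜ.powerset, ∑ f ∈ A.pi fun _ => U, ∑ G : SimpleGraph V,
          (binomialRandom V p).real {G} * G.expBallWeight t k (U ∪ A) (S ∪ parentEdges A f) := by
          rw [Finset.sum_comm]
          exact Finset.sum_congr rfl fun A _ => Finset.sum_comm
      _ ≤ ∑ A ∈ Uᶜ.powerset, ∑ f ∈ A.pi fun _ => U,
          (p : ℝ) ^ (S.card + A.card) * Real.exp (T * (U.card + A.card)) := by
          refine Finset.sum_le_sum fun A hA => Finset.sum_le_sum fun f hf => ?_
          have hAU : Disjoint U A :=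
            Finset.disjoint_left.2 fun x hx hxA =>
              Finset.mem_compl.1 (Finset.mem_powerset.1 hA hxA) hx
          have hfU := Finset.mem_pi.1 hf
          -- Edges of `S` lie inside `U`, while a parent edge has an end in `A`, outside `U`; hence
          -- the exponents of `p` add up.
          have hdisj : Disjoint S (parentEdges A f) := by
            refine Finset.disjoint_left.2 fun e he he' => ?_
            obtain ⟨a, ha, rfl⟩ := mem_parentEdges.1 he'
            exact Finset.disjoint_left.1 hAU (hSU _ he a (Sym2.mem_mk_right _ _)) ha
          refine (ih (U ∪ A) (S ∪ parentEdges A f) ?_ ?_).trans (le_of_eq ?_)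
          · intro e he
            rcases Finset.mem_union.1 he with he | he
            · exact hS e he
            · exact parentEdges_not_isDiag hAU hfU he
          · intro e he x hx
            rcases Finset.mem_union.1 he with he | he
            · exact Finset.mem_union_left _ (hSU e he x hx)
            · obtain ⟨a, ha, rfl⟩ := mem_parentEdges.1 he
              rcases Sym2.mem_iff.1 hx with rfl | rfl
              · exact Finset.mem_union_left _ (hfU a ha)
              · exact Finset.mem_union_right _ ha
          · rw [Finset.card_union_of_disjoint hdisj, card_parentEdges hAU hfU,
              Finset.card_union_of_disjoint hAU]
            push_cast
            rfl
      -- There are `U.card ^ A.card` parent maps, so the sum over `A` becomes a binomial expansion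
      -- of `(1 + U.card * p * exp T) ^ Uᶜ.card`.
      _ = ∑ A ∈ Uᶜ.powerset, (p : ℝ) ^ S.card * Real.exp (T * U.card) *
          ∏ _a ∈ A, ((U.card : ℝ) * p * Real.exp T) := by
          refine Finset.sum_congr rfl fun A _ => ?_
          rw [Finset.sum_const, Finset.card_pi, Finset.prod_const, Finset.prod_const,
            nsmul_eq_mul, mul_add, Real.exp_add, mul_comm T (A.card : ℝ), Real.exp_nat_mul]
          push_cast
          ring
      _ = (p : ℝ) ^ S.card * Real.exp (T * U.card) *
          (1 + (U.card : ℝ) * p * Real.exp T) ^ Uᶜ.card := by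
          rw [← Finset.mul_sum, ← Finset.prod_one_add, Finset.prod_const]
      _ ≤ (p : ℝ) ^ S.card * Real.exp (T * U.card) *
          Real.exp ((U.card : ℝ) * p * Real.exp T) ^ Fintype.card V := by
          have h0 : 0 ≤ (U.card : ℝ) * p * Real.exp T := by positivity
          refine mul_le_mul_of_nonneg_left ?_ (by positivity)
          calc _ ≤ (1 + (U.card : ℝ) * p * Real.exp T) ^ Fintype.card V :=
                pow_le_pow_right₀ (by linarith) (Finset.card_le_univ _)
            _ ≤ _ := by
                gcongr
                linarith [Real.add_one_le_exp ((U.card : ℝ) * p * Real.exp T)]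
      _ = _ := by
          rw [← Real.exp_nat_mul, mul_assoc, ← Real.exp_add, growthExponent, ← hT]
          ring_nf

/-- Markov's inequality for the exponential moment, starting from a single vertex and no prescribed
edges. -/
theorem binomialRandom_real_le_card_ballIn_le [Fintype V] [DecidableEq V] (p : I) {t : ℝ}
    (ht : 0 ≤ t) (k : ℕ) (v : V) (m : ℝ) :
    (binomialRandom V p).real {G | m ≤ (G.ballIn Finset.univ k {v}).card} ≤
      Real.exp (growthExponent (Fintype.card V * p) t k - t * m) := by
  classical
  have h := sum_exp_ballIn_le p t k {v} ∅ (by simp) (by simp)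
  simp only [expBallWeight, Finset.coe_empty, Set.empty_subset, if_true, Finset.card_empty, pow_zero, one_mul,
    Finset.card_singleton, Nat.cast_one, mul_one] at h
  rw [Real.exp_sub, le_div_iff₀ (Real.exp_pos _)]
  refine le_trans ?_ h
  rw [binomialRandom_real_eq_sum, Finset.sum_mul]
  refine Finset.sum_le_sum fun G _ => ?_
  split_ifs with hG
  · refine mul_le_mul_of_nonneg_left (Real.exp_le_exp.2 ?_) measureReal_nonneg
    exact mul_le_mul_of_nonneg_left hG ht
  · rw [zero_mul]
    exact mul_nonneg measureReal_nonneg (Real.exp_pos _).le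

/-! ### Repeated independent explorations -/

theorem binomialRandom_real_inter_of_disjoint [Fintype V] {p : I} {S T : Set (Sym2 V)}
    {A B : Set (SimpleGraph V)} (hST : Disjoint S T) (hA : DeterminedBy S A)
    (hB : DeterminedBy T B) :
    (binomialRandom V p).real (A ∩ B) =
      (binomialRandom V p).real A * (binomialRandom V p).real B := by
  refine binomialRandom_real_inter (S := S.toFinite.toFinset) (T := T.toFinite.toFinset) ?_
    (by simpa using hA) (by simpa using hB)
  rw [← Finset.disjoint_coe]
  simpa using hST

theorem determinedBy_ballIn_eq [DecidableEq V] (U : Finset V) (k : ℕ) (A W : Finset V) :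
    DeterminedBy {e | ∃ x ∈ W, ∃ y ∈ U, e = s(x, y)} {G : SimpleGraph V | G.ballIn U k A = W} := by
  intro G H h hG
  simp only [Set.mem_ofPred_eq] at hG ⊢
  rw [← hG]
  refine (ballIn_congr fun x hx y hy => ?_).symm
  exact h s(x, y) ⟨x, hG ▸ hx, y, hy, rfl⟩

theorem determinedBy_forall_card_ballIn_le [DecidableEq V] (U : Finset V) (k m : ℕ) :
    DeterminedBy {e | ∃ x ∈ U, ∃ y ∈ U, e = s(x, y)}
      {G : SimpleGraph V | ∀ v ∈ U, (G.ballIn U k {v}).card ≤ m} := by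
  intro G H h hG v hv
  have hsub := G.ballIn_subset k (Finset.singleton_subset_iff.2 hv)
  rw [← ballIn_congr fun x hx y hy => h s(x, y) ⟨x, hsub hx, y, hy, rfl⟩]
  exact hG v hv

/-- If a ball around a vertex of a large enough set is large with probability at least `q`, then
exploring small balls one after the other gives many independent attempts. -/
theorem binomialRandom_real_forall_card_ballIn_le_le [Fintype V] [DecidableEq V] {p : I}
    {k m u : ℕ} {q : ℝ} (hu : 0 < u) (hq : q ≤ 1)
    (h : ∀ U : Finset V, u ≤ U.card → ∀ v ∈ U,
      q ≤ (binomialRandom V p).real {G | m < (G.ballIn U k {v}).card})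
    (j : ℕ) {U : Finset V} (hU : u + j * m ≤ U.card) :
    (binomialRandom V p).real {G | ∀ v ∈ U, (G.ballIn U k {v}).card ≤ m} ≤ (1 - q) ^ j := by
  induction j generalizing U with
  | zero => simp
  | succ j ih =>
    obtain ⟨v, hv⟩ : U.Nonempty := Finset.card_pos.1 (by omega)
    set 𝒲 := U.powerset.filter fun W => W.card ≤ m with h𝒲
    -- Split by the small ball `W` found around `v`. Deleting `W` only shrinks the other balls, so
    -- they remain small in `U \ W`.
    have hsub : {G : SimpleGraph V | ∀ v ∈ U, (G.ballIn U k {v}).card ≤ m} ⊆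
        ⋃ W ∈ 𝒲, {G | G.ballIn U k {v} = W} ∩
          {G | ∀ v ∈ U \ W, (G.ballIn (U \ W) k {v}).card ≤ m} := by
      intro G hG
      simp only [Set.mem_iUnion]
      refine ⟨G.ballIn U k {v}, ?_, rfl, fun w hw => ?_⟩
      · exact Finset.mem_filter.2 ⟨Finset.mem_powerset.2
          (G.ballIn_subset k (Finset.singleton_subset_iff.2 hv)), hG v hv⟩
      · exact (Finset.card_le_card (G.ballIn_mono Finset.sdiff_subset subset_rfl k)).trans
          (hG w (Finset.sdiff_subset hw))
    have hle : ∀ W ∈ 𝒲, (binomialRandom V p).real ({G | G.ballIn U k {v} = W} ∩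
          {G | ∀ v ∈ U \ W, (G.ballIn (U \ W) k {v}).card ≤ m}) ≤
        (binomialRandom V p).real {G | G.ballIn U k {v} = W} * (1 - q) ^ j := by
      intro W hW
      obtain ⟨hWU, hWm⟩ := Finset.mem_filter.1 hW
      rw [binomialRandom_real_inter_of_disjoint ?_ (determinedBy_ballIn_eq U k {v} W)
        (determinedBy_forall_card_ballIn_le (U \ W) k m)]
      · refine mul_le_mul_of_nonneg_left (ih ?_) measureReal_nonneg
        rw [Finset.card_sdiff_of_subset (Finset.mem_powerset.1 hWU)]
        rw [add_mul] at hU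
        omega
      -- The first event looks at pairs meeting `W`, the second at pairs inside `U \ W`.
      · rw [Set.disjoint_left]
        rintro e ⟨x, hx, y, hy, rfl⟩ ⟨x', hx', y', hy', he⟩
        rcases Sym2.eq_iff.1 he with ⟨rfl, rfl⟩ | ⟨rfl, rfl⟩
        · exact (Finset.mem_sdiff.1 hx').2 hx
        · exact (Finset.mem_sdiff.1 hy').2 hx
    have hsum : ∑ W ∈ 𝒲, (binomialRandom V p).real {G | G.ballIn U k {v} = W} ≤ 1 - q := by
      rw [← measureReal_biUnion_finset]
      · have : (⋃ W ∈ 𝒲, {G : SimpleGraph V | G.ballIn U k {v} = W}) ⊆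
            {G | m < (G.ballIn U k {v}).card}ᶜ := by
          intro G hG
          simp only [Set.mem_iUnion] at hG
          obtain ⟨W, hW, hGW⟩ := hG
          have hGW : G.ballIn U k {v} = W := hGW
          simpa [hGW] using (Finset.mem_filter.1 hW).2
        refine (measureReal_mono this).trans ?_
        rw [probReal_compl_eq_one_sub (measurableSet_of_finite _)]
        have := h U (by omega) v hv
        linarith
      · intro W _ W' _ hne
        exact Set.disjoint_left.2 fun G hG hG' => hne (hG.symm.trans hG')
      · exact fun _ _ => measurableSet_of_finite _
    calc _ ≤ ∑ W ∈ 𝒲, (binomialRandom V p).real ({G | G.ballIn U k {v} = W} ∩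
          {G | ∀ v ∈ U \ W, (G.ballIn (U \ W) k {v}).card ≤ m}) :=
          (measureReal_mono hsub (measure_ne_top _ _)).trans (measureReal_biUnion_finset_le _ _)
      _ ≤ ∑ W ∈ 𝒲, (binomialRandom V p).real {G | G.ballIn U k {v} = W} * (1 - q) ^ j :=
          Finset.sum_le_sum hle
      _ ≤ (1 - q) * (1 - q) ^ j := by
          rw [← Finset.sum_mul]
          exact mul_le_mul_of_nonneg_right hsum (pow_nonneg (by linarith) _)
      _ = (1 - q) ^ (j + 1) := by ring

/-! ### Probability of prescribed layer sizes -/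

theorem determinedBy_neighborsIn_eq (U A W : Finset V) :
    DeterminedBy {e | ∃ x ∈ A, ∃ y ∈ U, e = s(x, y)}
      {G : SimpleGraph V | G.neighborsIn U A = W} := by
  intro G H h hG
  simp only [Set.mem_ofPred_eq] at hG ⊢
  rw [← hG]
  ext w
  simp only [mem_neighborsIn]
  refine and_congr_right fun hw => exists_congr fun a => and_congr_right fun ha => ?_
  exact (h s(a, w) ⟨a, ha, w, hw, rfl⟩).symm

/-- Only graphs in which every vertex of `W` has exactly one neighbour in `A` are counted. For each
of the `A.card ^ W.card` parent maps the edges between `A` and `U` are then fixed, and different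
maps give disjoint events. -/
theorem pow_mul_pow_le_binomialRandom_real_neighborsIn_eq [Fintype V] [DecidableEq V] (p : I)
    {A U W : Finset V} (hAU : Disjoint A U) (hWU : W ⊆ U) :
    (A.card * p : ℝ) ^ W.card * (1 - p : ℝ) ^ (A.card * U.card) ≤
      (binomialRandom V p).real {G | G.neighborsIn U A = W} := by
  have hp0 : 0 ≤ (p : ℝ) := p.2.1
  have hp1 : (p : ℝ) ≤ 1 := p.2.2
  have hAW : Disjoint A W := Finset.disjoint_of_subset_right hWU hAU
  set C : Finset (Sym2 V) := (A ×ˢ U).image fun x => s(x.1, x.2) with hC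
  have hCd : ∀ e ∈ C, ¬ e.IsDiag := by
    intro e he
    obtain ⟨⟨x, y⟩, hxy, rfl⟩ := Finset.mem_image.1 he
    obtain ⟨hx, hy⟩ := Finset.mem_product.1 hxy
    rw [Sym2.mk_isDiag_iff]
    rintro (rfl : x = y)
    exact Finset.disjoint_left.1 hAU hx hy
  set B : (∀ w ∈ W, V) → Set (SimpleGraph V) := fun f =>
    {G | ((parentEdges W f : Finset (Sym2 V)) : Set (Sym2 V)) ⊆ G.edgeSet} ∩
      {G | Disjoint ((C \ parentEdges W f : Finset (Sym2 V)) : Set (Sym2 V)) G.edgeSet} with hB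
  have hBsub : ∀ f ∈ W.pi fun _ => A, B f ⊆ {G | G.neighborsIn U A = W} := by
    rintro f hf G ⟨hG1, hG2⟩
    have hfA := Finset.mem_pi.1 hf
    simp only [Set.mem_ofPred_eq] at hG1 hG2 ⊢
    ext w
    rw [mem_neighborsIn]
    constructor
    · rintro ⟨hw, a, ha, haw⟩
      have h1 : s(a, w) ∈ C := Finset.mem_image.2 ⟨(a, w), Finset.mem_product.2 ⟨ha, hw⟩, rfl⟩
      have h2 : s(a, w) ∈ parentEdges W f := by
        by_contra h2
        exact Set.disjoint_left.1 hG2 (Finset.mem_coe.2 (Finset.mem_sdiff.2 ⟨h1, h2⟩)) haw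
      obtain ⟨b, hb, hbe⟩ := mem_parentEdges.1 h2
      rcases Sym2.eq_iff.1 hbe with ⟨-, rfl⟩ | ⟨-, rfl⟩
      · exact hb
      · exact absurd hb (Finset.disjoint_left.1 hAW ha)
    · intro hw
      exact ⟨hWU hw, f w hw, hfA w hw, hG1 (Finset.mem_coe.2 (mem_parentEdges.2 ⟨w, hw, rfl⟩))⟩
  have hBdisj : (↑(W.pi fun _ => A) : Set (∀ w ∈ W, V)).PairwiseDisjoint B := by
    intro f hf g hg hfg
    refine Set.disjoint_left.2 fun G hGf hGg => hfg ?_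
    have hfA := Finset.mem_pi.1 (Finset.mem_coe.1 hf)
    have hgA := Finset.mem_pi.1 (Finset.mem_coe.1 hg)
    funext w hw
    have h1 : s(g w hw, w) ∈ C :=
      Finset.mem_image.2 ⟨(g w hw, w), Finset.mem_product.2 ⟨hgA w hw, hWU hw⟩, rfl⟩
    have h2 : s(g w hw, w) ∈ parentEdges W f := by
      by_contra h2
      exact Set.disjoint_left.1 hGf.2 (Finset.mem_coe.2 (Finset.mem_sdiff.2 ⟨h1, h2⟩))
        (hGg.1 (Finset.mem_coe.2 (mem_parentEdges.2 ⟨w, hw, rfl⟩)))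
    obtain ⟨b, hb, hbe⟩ := mem_parentEdges.1 h2
    rcases Sym2.eq_iff.1 hbe with ⟨h3, rfl⟩ | ⟨h3, -⟩
    · exact h3
    · exact absurd hw (Finset.disjoint_left.1 hAW (h3 ▸ hfA b hb))
  have hBprob : ∀ f ∈ W.pi fun _ => A, (p : ℝ) ^ W.card * (1 - p : ℝ) ^ (A.card * U.card) ≤
      (binomialRandom V p).real (B f) := by
    intro f hf
    have hfA := Finset.mem_pi.1 hf
    rw [hB, binomialRandom_real_inter Finset.disjoint_sdiff (determinedBy_subset_edgeSet _)
      (determinedBy_disjoint_edgeSet _), binomialRandom_real_subset_edgeSet p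
        fun e he => parentEdges_not_isDiag hAW hfA he, card_parentEdges hAW hfA,
      binomialRandom_real_disjoint_edgeSet p fun e he => hCd e (Finset.sdiff_subset he)]
    refine mul_le_mul_of_nonneg_left (pow_le_pow_of_le_one (by linarith) (by linarith) ?_)
      (pow_nonneg hp0 _)
    exact (Finset.card_le_card Finset.sdiff_subset).trans
      (Finset.card_image_le.trans (Finset.card_product _ _).le)
  calc _ = ∑ _f ∈ W.pi fun _ => A, (p : ℝ) ^ W.card * (1 - p : ℝ) ^ (A.card * U.card) := by
        rw [Finset.sum_const, Finset.card_pi, Finset.prod_const, nsmul_eq_mul]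
        push_cast
        ring
    _ ≤ ∑ f ∈ W.pi fun _ => A, (binomialRandom V p).real (B f) := Finset.sum_le_sum hBprob
    _ = (binomialRandom V p).real (⋃ f ∈ W.pi fun _ => A, B f) :=
        (measureReal_biUnion_finset hBdisj fun _ _ => measurableSet_of_finite _).symm
    _ ≤ _ := measureReal_mono (Set.iUnion₂_subset hBsub)

/-- Exploring `k` layers from `A` into `U`, the `i`-th layer has exactly `a i` vertices. -/
def HasLayers [DecidableEq V] (G : SimpleGraph V) : ℕ → (ℕ → ℕ) → Finset V → Finset V → Prop
  | 0, _, _, _ => True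
  | k + 1, a, A, U => (G.neighborsIn U A).card = a 1 ∧
      HasLayers G k (fun i => a (i + 1)) (G.neighborsIn U A) (U \ G.neighborsIn U A)

theorem determinedBy_hasLayers [DecidableEq V] (k : ℕ) (a : ℕ → ℕ) (A U : Finset V) :
    DeterminedBy {e | ∃ x ∈ A ∪ U, ∃ y ∈ U, e = s(x, y)}
      {G : SimpleGraph V | G.HasLayers k a A U} := by
  induction k generalizing a A U with
  | zero => exact fun _ _ _ _ => trivial
  | succ k ih =>
    rintro G H h ⟨hG1, hG2⟩
    have hN : H.neighborsIn U A = G.neighborsIn U A :=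
      determinedBy_neighborsIn_eq U A (G.neighborsIn U A) G H (fun e ⟨x, hx, y, hy, he⟩ =>
        h e ⟨x, Finset.mem_union_left _ hx, y, hy, he⟩) rfl
    refine ⟨hN.symm ▸ hG1, ?_⟩
    rw [hN]
    refine ih _ _ _ G H (fun e ⟨x, hx, y, hy, he⟩ => h e ⟨x, ?_, y, Finset.sdiff_subset hy, he⟩) hG2
    refine Finset.mem_union_right _ ?_
    rcases Finset.mem_union.1 hx with hx | hx
    · exact G.neighborsIn_subset U A hx
    · exact Finset.sdiff_subset hx

/-- The ball accumulates its sources while the layers do not, so the induction carries a source `B`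
containing the current layer. -/
theorem HasLayers.exists_subset_ballIn [DecidableEq V] {G : SimpleGraph V} {k : ℕ} {a : ℕ → ℕ}
    {A U B U' : Finset V} (h : G.HasLayers (k + 1) a A U) (hAB : A ⊆ B) (hU : U ⊆ U') :
    ∃ L ⊆ U, L.card = a (k + 1) ∧ L ⊆ G.ballIn U' (k + 1) B := by
  induction k generalizing a A U B with
  | zero =>
    exact ⟨G.neighborsIn U A, G.neighborsIn_subset U A, h.1,
      (G.neighborsIn_mono hU hAB).trans Finset.subset_union_right⟩
  | succ k ih =>
    obtain ⟨L, hLU, hL, hLB⟩ := ih (B := B ∪ G.neighborsIn U' B) h.2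
      ((G.neighborsIn_mono hU hAB).trans Finset.subset_union_right)
      (Finset.sdiff_subset.trans hU)
    exact ⟨L, hLU.trans Finset.sdiff_subset, hL, hLB⟩

theorem pow_le_choose_mul_pow {u n a : ℕ} (h : u + a ≤ n) : u ^ a ≤ n.choose a * a ^ a := by
  have h1 : n.descFactorial a = a.factorial * n.choose a :=
    Nat.descFactorial_eq_factorial_mul_choose n a
  calc u ^ a ≤ (n + 1 - a) ^ a := Nat.pow_le_pow_left (by omega) a
    _ ≤ n.descFactorial a := Nat.pow_sub_le_descFactorial n a
    _ = n.choose a * a.factorial := by rw [h1, mul_comm]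
    _ ≤ n.choose a * a ^ a := Nat.mul_le_mul_left _ (Nat.factorial_le_pow a)

/-- Sum over the possible first layers `W`: there are at least `(u / a 1) ^ a 1` of them. The first
layer depends on pairs between `A` and `U` and the later ones on pairs inside `U`, so the
probabilities multiply. -/
theorem prod_le_binomialRandom_real_hasLayers [Fintype V] [DecidableEq V] (p : I) {u : ℕ} (k : ℕ)
    (a : ℕ → ℕ) {A U : Finset V} (hAU : Disjoint A U) (hA : A.card = a 0)
    (hU : u + ∑ i ∈ Finset.range k, a (i + 1) ≤ U.card) :
    ∏ i ∈ Finset.range k, ((u * a i * p / a (i + 1) : ℝ) ^ a (i + 1) *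
        (1 - p : ℝ) ^ (a i * Fintype.card V)) ≤
      (binomialRandom V p).real {G | G.HasLayers k a A U} := by
  have hp0 : 0 ≤ (p : ℝ) := p.2.1
  have hp1 : (p : ℝ) ≤ 1 := p.2.2
  have hp2 : 0 ≤ (1 - p : ℝ) := by linarith
  induction k generalizing a A U with
  | zero => simp [HasLayers]
  | succ k ih =>
    rw [Finset.sum_range_succ'] at hU
    rw [Finset.prod_range_succ', zero_add]
    simp only [zero_add] at hU
    set P := ∏ i ∈ Finset.range k, ((u * a (i + 1) * p / a (i + 1 + 1) : ℝ) ^ a (i + 1 + 1) *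
        (1 - p : ℝ) ^ (a (i + 1) * Fintype.card V)) with hP
    have hP0 : 0 ≤ P := Finset.prod_nonneg fun i _ => by positivity
    have hsub : (⋃ W ∈ U.powersetCard (a 1), {G : SimpleGraph V | G.neighborsIn U A = W} ∩
        {G | G.HasLayers k (fun i => a (i + 1)) W (U \ W)}) ⊆
        {G | G.HasLayers (k + 1) a A U} := by
      refine Set.iUnion₂_subset fun W hW => ?_
      rintro G ⟨hG1, hG2⟩
      have hG1 : G.neighborsIn U A = W := hG1
      subst hG1
      exact ⟨(Finset.mem_powersetCard.1 hW).2, hG2⟩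
    have hterm : ∀ W ∈ U.powersetCard (a 1),
        ((a 0 * p : ℝ) ^ a 1 * (1 - p : ℝ) ^ (a 0 * Fintype.card V)) * P ≤
        (binomialRandom V p).real ({G | G.neighborsIn U A = W} ∩
          {G | G.HasLayers k (fun i => a (i + 1)) W (U \ W)}) := by
      intro W hW
      obtain ⟨hWU, hWc⟩ := Finset.mem_powersetCard.1 hW
      rw [binomialRandom_real_inter_of_disjoint ?_ (determinedBy_neighborsIn_eq U A W)
        (determinedBy_hasLayers k _ W (U \ W))]
      · refine mul_le_mul ?_ (ih (fun i => a (i + 1)) Finset.disjoint_sdiff hWc ?_) hP0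
          measureReal_nonneg
        · refine le_trans ?_ (pow_mul_pow_le_binomialRandom_real_neighborsIn_eq p hAU hWU)
          rw [hA, hWc]
          refine mul_le_mul_of_nonneg_left (pow_le_pow_of_le_one hp2 (by linarith) ?_)
            (by positivity)
          exact Nat.mul_le_mul_left _ (Finset.card_le_univ _)
        · rw [Finset.card_sdiff_of_subset hWU, hWc]
          omega
      · rw [Set.disjoint_left]
        rintro e ⟨x, hx, y, hy, rfl⟩ ⟨x', hx', y', hy', he⟩
        have hxU : x ∉ U := Finset.disjoint_left.1 hAU hx
        have hx'U : x' ∈ U := by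
          rcases Finset.mem_union.1 hx' with h | h
          · exact hWU h
          · exact Finset.sdiff_subset h
        rcases Sym2.eq_iff.1 he with ⟨rfl, rfl⟩ | ⟨rfl, rfl⟩
        · exact hxU hx'U
        · exact hxU (Finset.sdiff_subset hy')
    calc _ ≤ ∑ _W ∈ U.powersetCard (a 1),
          ((a 0 * p : ℝ) ^ a 1 * (1 - p : ℝ) ^ (a 0 * Fintype.card V)) * P := by
          rw [Finset.sum_const, Finset.card_powersetCard, nsmul_eq_mul, mul_comm P, ← mul_assoc,
            ← mul_assoc]
          refine mul_le_mul_of_nonneg_right (mul_le_mul_of_nonneg_right ?_ (by positivity)) hP0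
          have h1 : (u : ℝ) ^ a 1 ≤ U.card.choose (a 1) * (a 1 : ℝ) ^ a 1 := by
            exact_mod_cast pow_le_choose_mul_pow (u := u) (n := U.card) (a := a 1) (by omega)
          rcases Nat.eq_zero_or_pos (a 1) with h0 | h0
          · simp [h0]
          · rw [mul_assoc, mul_div_right_comm, mul_pow]
            refine mul_le_mul_of_nonneg_right ?_ (by positivity)
            rw [div_pow, div_le_iff₀ (by positivity)]
            exact h1
      _ ≤ ∑ W ∈ U.powersetCard (a 1),
          (binomialRandom V p).real ({G | G.neighborsIn U A = W} ∩
          {G | G.HasLayers k (fun i => a (i + 1)) W (U \ W)}) := Finset.sum_le_sum hterm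
      _ = (binomialRandom V p).real (⋃ W ∈ U.powersetCard (a 1),
          ({G : SimpleGraph V | G.neighborsIn U A = W} ∩
          {G | G.HasLayers k (fun i => a (i + 1)) W (U \ W)})) := by
          refine (measureReal_biUnion_finset ?_ fun _ _ => measurableSet_of_finite _).symm
          intro W _ W' _ hne
          exact Set.disjoint_left.2 fun G hG hG' => hne (hG.1.symm.trans hG'.1)
      _ ≤ _ := measureReal_mono hsub

/-- The probability that no ball of radius `k + 1` has more than `a (k + 1)` vertices, in terms of
the size `a i` of the layers that are to be found around some vertex. -/
theorem binomialRandom_real_forall_card_ballIn_univ_le_le [Fintype V] [DecidableEq V] (p : I)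
    {u j k : ℕ} (a : ℕ → ℕ) (ha : a 0 = 1)
    (hu : u + ∑ i ∈ Finset.range (k + 1), a (i + 1) + 1 + j * a (k + 1) ≤ Fintype.card V) :
    (binomialRandom V p).real
        {G | ∀ v, (G.ballIn Finset.univ (k + 1) {v}).card ≤ a (k + 1)} ≤
      Real.exp (-(j * ∏ i ∈ Finset.range (k + 1), ((u * a i * p / a (i + 1) : ℝ) ^ a (i + 1) *
        (1 - p : ℝ) ^ (a i * Fintype.card V)))) := by
  set q := ∏ i ∈ Finset.range (k + 1), ((u * a i * p / a (i + 1) : ℝ) ^ a (i + 1) *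
        (1 - p : ℝ) ^ (a i * Fintype.card V)) with hq
  have key : ∀ U : Finset V, u + ∑ i ∈ Finset.range (k + 1), a (i + 1) + 1 ≤ U.card → ∀ v ∈ U,
      q ≤ (binomialRandom V p).real {G | a (k + 1) < (G.ballIn U (k + 1) {v}).card} := by
    intro U hU v hv
    refine (prod_le_binomialRandom_real_hasLayers p (u := u) (k + 1) a (A := {v})
      (U := U.erase v) (by simp) (by simp [ha]) ?_).trans (measureReal_mono fun G hG => ?_)
    · rw [Finset.card_erase_of_mem hv]
      omega
    -- The last layer together with `v` itself makes the inequality strict.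
    · obtain ⟨L, hLU, hL, hLB⟩ := HasLayers.exists_subset_ballIn hG subset_rfl
        (Finset.erase_subset v U)
      have hvL : v ∉ L := fun h => Finset.notMem_erase v U (hLU h)
      have : (insert v L).card ≤ (G.ballIn U (k + 1) {v}).card :=
        Finset.card_le_card (Finset.insert_subset
          (G.subset_ballIn U (k + 1) {v} (Finset.mem_singleton_self v)) hLB)
      rw [Finset.card_insert_of_notMem hvL, hL] at this
      exact this
  have huniv : u + ∑ i ∈ Finset.range (k + 1), a (i + 1) + 1 + j * a (k + 1) ≤
      (Finset.univ : Finset V).card := by rwa [Finset.card_univ]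
  have hq1 : q ≤ 1 := by
    obtain ⟨v⟩ : Nonempty V := Fintype.card_pos_iff.1 (by omega)
    exact (key Finset.univ (by omega) v (Finset.mem_univ v)).trans measureReal_le_one
  have h := binomialRandom_real_forall_card_ballIn_le_le (by omega) hq1 key j huniv
  simp only [Finset.mem_univ, forall_true_left] at h
  refine h.trans ?_
  rw [← mul_neg, Real.exp_nat_mul]
  exact pow_le_pow_left₀ (by linarith) (Real.one_sub_le_exp_neg q) j

end SimpleGraph

/-! ### Asymptotics of the upper bound -/

theorem tendsto_log_iterate_atTop (k : ℕ) : Tendsto Real.log^[k] atTop atTop := by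
  induction k with
  | zero => exact tendsto_id
  | succ k ih =>
    rw [Function.iterate_succ']
    exact Real.tendsto_log_atTop.comp ih

/-- Here `exp T ≤ g ^ η`, which is `o(g)` because `η < 1`. -/
theorem eventually_add_mul_exp_le {c η ε : ℝ} (hc : 0 ≤ c) (hη0 : 0 < η) (hη : η < 1) (hε : 0 < ε)
    {g T : ℕ → ℝ} (hg : Tendsto g atTop atTop) (hT : ∀ᶠ n in atTop, T n ≤ η * Real.log (g n)) :
    ∀ᶠ n in atTop, T n + c * Real.exp (T n) ≤ ε * g n := by
  have h1 : Tendsto (fun x : ℝ => Real.log x / x + c * x ^ (-(1 - η))) atTop (𝓝 (0 + c * 0)) := by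
    refine Tendsto.add ?_ (Tendsto.const_mul c (tendsto_rpow_neg_atTop (by linarith)))
    simpa using Real.isLittleO_log_id_atTop.tendsto_div_nhds_zero
  rw [mul_zero, add_zero] at h1
  filter_upwards [hT, hg.eventually (h1.eventually (gt_mem_nhds hε)),
    hg.eventually (eventually_gt_atTop 1)] with n hTn h2 h3
  have hg0 : 0 < g n := by linarith
  have hlog : 0 ≤ Real.log (g n) := Real.log_nonneg h3.le
  have h4 : Real.exp (T n) ≤ g n ^ (-(1 - η)) * g n := by
    calc Real.exp (T n) ≤ Real.exp (Real.log (g n) * η) :=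
          Real.exp_le_exp.2 (by linarith)
      _ = g n ^ η := (Real.rpow_def_of_pos hg0 η).symm
      _ = g n ^ (-(1 - η) + 1) := by ring_nf
      _ = _ := by rw [Real.rpow_add hg0, Real.rpow_one]
  calc T n + c * Real.exp (T n) ≤ Real.log (g n) + c * (g n ^ (-(1 - η)) * g n) := by
        refine add_le_add ?_ (mul_le_mul_of_nonneg_left h4 hc)
        nlinarith
    _ = (Real.log (g n) / g n + c * g n ^ (-(1 - η))) * g n := by field_simp
    _ ≤ ε * g n := mul_le_mul_of_nonneg_right h2.le hg0.le

open SimpleGraph in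
theorem eventually_growthExponent_le {c η ε : ℝ} (hc : 0 ≤ c) (hη0 : 0 < η) (hη : η < 1)
    (hε : 0 < ε) (k : ℕ) {g t : ℕ → ℝ} (hg : Tendsto g atTop atTop)
    (ht : ∀ᶠ n in atTop, t n ≤ η * Real.log^[k + 1] (g n)) :
    ∀ᶠ n in atTop, growthExponent c (t n) (k + 1) ≤ ε * g n := by
  induction k generalizing g ε with
  | zero => exact eventually_add_mul_exp_le hc hη0 hη hε hg ht
  | succ k ih =>
    -- The induction hypothesis for `log g` bounds the previous exponent by `log g / 2`. The factor
    -- `η` is needed only at the innermost step; any constant below 1 serves afterwards.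
    exact eventually_add_mul_exp_le hc (by norm_num) (by norm_num) hε hg
      (ih (ε := 1 / 2) (by norm_num) (Real.tendsto_log_atTop.comp hg) ht)

namespace SimpleGraph

theorem tendsto_binomialRandom_exists_le_card_ballIn {c : ℝ} (hc : 0 < c) (k : ℕ)
    {p : ℕ → unitInterval} (hp : ∀ᶠ n : ℕ in atTop, (p n : ℝ) = c / n) {ε : ℝ} (hε : 0 < ε) :
    Tendsto (fun n : ℕ => (binomialRandom (Fin n) (p n)).real
      {G | ∃ v, (1 + ε) * (Real.log n / iteratedLog (k + 2) n) ≤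
        (G.ballIn Finset.univ (k + 1) {v}).card}) atTop (𝓝 0) := by
  have hlogn : Tendsto (fun n : ℕ => Real.log n) atTop atTop :=
    Real.tendsto_log_atTop.comp tendsto_natCast_atTop_atTop
  have hH : Tendsto (fun n : ℕ => iteratedLog (k + 2) n) atTop atTop :=
    (tendsto_log_iterate_atTop (k + 2)).comp tendsto_natCast_atTop_atTop
  -- Chosen so that `η * (1 + ε) = 1 + ε / 2`: below 1, yet Markov's exponent still exceeds `log n`
  -- by `ε / 2 * log n`.
  set η : ℝ := 1 - ε / (2 * (1 + ε)) with hη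
  have hηε : η * (1 + ε) = 1 + ε / 2 := by rw [hη]; field_simp; ring
  have hη0 : 0 < η := by
    by_contra h
    nlinarith
  have hη1 : η < 1 := by
    have : 0 < ε / (2 * (1 + ε)) := by positivity
    linarith
  have hT := eventually_growthExponent_le hc.le hη0 hη1 (ε := ε / 4) (by positivity) k hlogn
    (t := fun n => η * iteratedLog (k + 2) n) (Eventually.of_forall fun n => le_rfl)
  have hlim : Tendsto (fun n : ℕ => Real.exp (-(ε / 4 * Real.log n))) atTop (𝓝 0) :=
    Real.tendsto_exp_neg_atTop_nhds_zero.comp (hlogn.const_mul_atTop (by positivity))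
  refine tendsto_of_tendsto_of_tendsto_of_le_of_le' tendsto_const_nhds hlim
    (Eventually.of_forall fun n => measureReal_nonneg) ?_
  filter_upwards [hp, hT, hH.eventually (eventually_gt_atTop 0), eventually_gt_atTop 0]
    with n hpn hTn hHn hn
  have hn0 : (0 : ℝ) < n := by exact_mod_cast hn
  set h := iteratedLog (k + 2) n with hh
  have hcn : (Fintype.card (Fin n) : ℝ) * p n = c := by
    rw [hpn, Fintype.card_fin]; field_simp
  have hunion : {G : SimpleGraph (Fin n) | ∃ v, (1 + ε) * (Real.log n / h) ≤
        (G.ballIn Finset.univ (k + 1) {v}).card} ⊆ ⋃ v ∈ (Finset.univ : Finset (Fin n)),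
      {G | (1 + ε) * (Real.log n / h) ≤ (G.ballIn Finset.univ (k + 1) {v}).card} := by
    rintro G ⟨v, hv⟩
    simpa using ⟨v, hv⟩
  calc _ ≤ ∑ v : Fin n, (binomialRandom (Fin n) (p n)).real
        {G | (1 + ε) * (Real.log n / h) ≤ (G.ballIn Finset.univ (k + 1) {v}).card} :=
        (measureReal_mono hunion (measure_ne_top _ _)).trans (measureReal_biUnion_finset_le _ _)
    _ ≤ ∑ _v : Fin n, Real.exp (ε / 4 * Real.log n - (1 + ε / 2) * Real.log n) := by
        refine Finset.sum_le_sum fun v _ => (binomialRandom_real_le_card_ballIn_le (p n)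
          (t := η * h) (by positivity) (k + 1) v _).trans (Real.exp_le_exp.2 ?_)
        rw [hcn]
        refine sub_le_sub hTn (le_of_eq ?_)
        rw [← hηε]
        field_simp
    _ = Real.exp (Real.log n) * Real.exp (ε / 4 * Real.log n - (1 + ε / 2) * Real.log n) := by
        rw [Finset.sum_const, Finset.card_univ, Fintype.card_fin, nsmul_eq_mul, Real.exp_log hn0]
    _ = Real.exp (-(ε / 4 * Real.log n)) := by rw [← Real.exp_add]; ring_nf

end SimpleGraph

/-! ### Choice of the layer sizes -/

theorem tendsto_log_iterate_succ_sq_div (i : ℕ) :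
    Tendsto (fun L : ℝ => (Real.log^[i + 1] L) ^ 2 / L) atTop (𝓝 0) := by
  induction i with
  | zero => simpa using (Real.isLittleO_pow_log_id_atTop (n := 2)).tendsto_div_nhds_zero
  | succ i ih =>
    refine squeeze_zero' ?_ ?_ ih
    · filter_upwards [eventually_gt_atTop 0] with L hL
      positivity
    · filter_upwards [eventually_gt_atTop 0,
        (tendsto_log_iterate_atTop (i + 1)).eventually (eventually_ge_atTop 1)] with L hL h1
      rw [Function.iterate_succ_apply' _ (i + 1)]
      have h2 := Real.log_nonneg h1
      have h3 := Real.log_le_sub_one_of_pos (by linarith : 0 < Real.log^[i + 1] L)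
      gcongr
      linarith

theorem tendsto_log_iterate_succ_div (i : ℕ) :
    Tendsto (fun L : ℝ => Real.log^[i + 1] L / L) atTop (𝓝 0) := by
  refine squeeze_zero' ?_ ?_ (tendsto_log_iterate_succ_sq_div i)
  · filter_upwards [eventually_gt_atTop 0,
      (tendsto_log_iterate_atTop (i + 1)).eventually (eventually_ge_atTop 1)] with L hL h1
    positivity
  · filter_upwards [eventually_gt_atTop 0,
      (tendsto_log_iterate_atTop (i + 1)).eventually (eventually_ge_atTop 1)] with L hL h1
    gcongr
    nlinarith

/-- The factor by which the `i`-th layer is smaller than `L / log^[i] L`. -/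
noncomputable def layerFactor (k : ℕ) (ε : ℝ) (i : ℕ) (L : ℝ) : ℝ :=
  if i = k + 1 then 1 - ε else (Real.log^[i + 1] L)⁻¹

/-- The sizes of the layers of a ball of radius `k + 1` that is likely to be found in a sparse
random graph with `exp L` vertices. -/
noncomputable def layerSize (k : ℕ) (ε L : ℝ) (i : ℕ) : ℕ :=
  if i = 0 then 1 else ⌈L / Real.log^[i] L * layerFactor k ε i L⌉₊

section layerSize

variable {k : ℕ} {ε : ℝ}

theorem tendsto_layerFactor (i : ℕ) :
    Tendsto (layerFactor k ε i) atTop (𝓝 (if i = k + 1 then 1 - ε else 0)) := by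
  unfold layerFactor
  split_ifs
  · exact tendsto_const_nhds
  · exact tendsto_inv_atTop_zero.comp (tendsto_log_iterate_atTop (i + 1))

theorem eventually_layerFactor_le_one (hε0 : 0 < ε) (i : ℕ) :
    ∀ᶠ L in atTop, layerFactor k ε i L ≤ 1 := by
  filter_upwards [(tendsto_log_iterate_atTop (i + 1)).eventually (eventually_ge_atTop 1)] with L h
  unfold layerFactor
  split_ifs
  · linarith
  · exact inv_le_one_of_one_le₀ h

theorem eventually_one_le_div_mul_layerFactor (hε1 : ε < 1) (i : ℕ) :
    ∀ᶠ L in atTop, 1 ≤ L / Real.log^[i + 1] L * layerFactor k ε (i + 1) L := by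
  unfold layerFactor
  split_ifs with hik
  · filter_upwards [(tendsto_log_iterate_succ_div i).eventually
      (gt_mem_nhds (by linarith : 0 < 1 - ε)), eventually_gt_atTop 0,
      (tendsto_log_iterate_atTop (i + 1)).eventually (eventually_ge_atTop 1)] with L h hL h1
    rw [div_lt_iff₀ hL] at h
    rw [div_mul_eq_mul_div, one_le_div (by linarith)]
    linarith
  · filter_upwards [(tendsto_log_iterate_succ_sq_div i).eventually
      (gt_mem_nhds (by norm_num : (0 : ℝ) < 1)), eventually_gt_atTop 0,
      (tendsto_log_iterate_atTop (i + 1)).eventually (eventually_ge_atTop 1),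
      (tendsto_log_iterate_atTop (i + 1 + 1)).eventually (eventually_ge_atTop 1)] with L h hL h1 h2
    rw [div_lt_iff₀ hL] at h
    rw [← div_eq_mul_inv, div_div, one_le_div (by positivity)]
    -- The next iterate is smaller than this one, so the product of the two is at most the square,
    -- which is below `L`.
    have h3 := Real.log_le_sub_one_of_pos (by linarith : 0 < Real.log^[i + 1] L)
    rw [Function.iterate_succ_apply' _ (i + 1)] at h2 ⊢
    nlinarith

theorem one_le_layerSize (hε1 : ε < 1) (i : ℕ) : ∀ᶠ L in atTop, 1 ≤ layerSize k ε L i := by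
  cases i with
  | zero => simp [layerSize]
  | succ i =>
    filter_upwards [eventually_one_le_div_mul_layerFactor (k := k) hε1 i] with L hL
    rw [layerSize, if_neg (Nat.succ_ne_zero i), Nat.one_le_ceil_iff]
    linarith

/-- The extra divisor `log^[i+1] L` in layer `i` cancels the denominator of layer `i + 1`, leaving
the ratio `log^[i] L`. The factor 2 absorbs the ceiling, as the rounded quantity is at least 1. -/
theorem layerSize_succ_le (hε0 : 0 < ε) (hε1 : ε < 1) {i : ℕ} (hi : i ≤ k) :
    ∀ᶠ L in atTop, (layerSize k ε L (i + 1) : ℝ) ≤ 2 * Real.log^[i] L * layerSize k ε L i := by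
  have hceil : ∀ᶠ L in atTop, (layerSize k ε L (i + 1) : ℝ) ≤
      2 * (L / Real.log^[i + 1] L * layerFactor k ε (i + 1) L) := by
    filter_upwards [eventually_one_le_div_mul_layerFactor (k := k) hε1 i] with L h
    rw [layerSize, if_neg (Nat.succ_ne_zero i)]
    have := Nat.ceil_lt_add_one (a := L / Real.log^[i + 1] L * layerFactor k ε (i + 1) L)
      (by linarith)
    linarith
  filter_upwards [hceil, eventually_layerFactor_le_one (k := k) hε0 (i + 1), eventually_gt_atTop 0,
    (tendsto_log_iterate_atTop i).eventually (eventually_ge_atTop 1),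
    (tendsto_log_iterate_atTop (i + 1)).eventually (eventually_ge_atTop 1)] with L h1 h2 hL h3 h4
  refine h1.trans ?_
  rw [mul_assoc]
  refine mul_le_mul_of_nonneg_left ?_ (by norm_num)
  have h5 : L / Real.log^[i + 1] L * layerFactor k ε (i + 1) L ≤ L / Real.log^[i + 1] L :=
    mul_le_of_le_one_right (by positivity) h2
  refine h5.trans ?_
  cases i with
  | zero =>
    simp only [layerSize, Function.iterate_zero, id, if_true, Nat.cast_one, mul_one]
    exact div_le_self hL.le h4
  | succ i =>
    have h6 : L / Real.log^[i + 1] L * layerFactor k ε (i + 1) L ≤ layerSize k ε L (i + 1) := by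
      rw [layerSize, if_neg (Nat.succ_ne_zero i)]
      exact Nat.le_ceil _
    refine le_trans (le_of_eq ?_) (mul_le_mul_of_nonneg_left h6 (by linarith))
    rw [layerFactor, if_neg (by omega)]
    field_simp

/-- This is the leading cost of a layer relative to `L`: only the last layer contributes in the
limit. The ceiling adds at most `log^[i+1] L / L`. -/
theorem tendsto_layerSize_succ_mul_div (hε1 : ε < 1) (i : ℕ) :
    Tendsto (fun L => layerSize k ε L (i + 1) * Real.log^[i + 1] L / L) atTop
      (𝓝 (if i = k then 1 - ε else 0)) := by
  have h1 := tendsto_layerFactor (k := k) (ε := ε) (i + 1)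
  simp only [Nat.add_right_cancel_iff] at h1
  have h2 := h1.add (tendsto_log_iterate_succ_div i)
  rw [add_zero] at h2
  have hev : ∀ᶠ L : ℝ in atTop, 0 < L ∧ 1 ≤ Real.log^[i + 1] L ∧
      1 ≤ L / Real.log^[i + 1] L * layerFactor k ε (i + 1) L :=
    (eventually_gt_atTop 0).and (((tendsto_log_iterate_atTop (i + 1)).eventually
      (eventually_ge_atTop 1)).and (eventually_one_le_div_mul_layerFactor hε1 i))
  refine tendsto_of_tendsto_of_tendsto_of_le_of_le' h1 h2 ?_ ?_
  · filter_upwards [hev] with L ⟨hL, h3, h4⟩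
    rw [layerSize, if_neg (Nat.succ_ne_zero i), le_div_iff₀ hL]
    refine le_trans (le_of_eq ?_) (mul_le_mul_of_nonneg_right (Nat.le_ceil _) (by linarith))
    field_simp
  · filter_upwards [hev] with L ⟨hL, h3, h4⟩
    rw [layerSize, if_neg (Nat.succ_ne_zero i), div_le_iff₀ hL]
    refine (mul_le_mul_of_nonneg_right (Nat.ceil_lt_add_one (by linarith)).le
      (by linarith)).trans (le_of_eq ?_)
    field_simp

theorem tendsto_layerSize_div (hε1 : ε < 1) (i : ℕ) :
    Tendsto (fun L => (layerSize k ε L i : ℝ) / L) atTop (𝓝 0) := by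
  cases i with
  | zero => simpa [layerSize] using tendsto_inv_atTop_zero (𝕜 := ℝ)
  | succ i =>
    have h := (tendsto_layerSize_succ_mul_div (k := k) hε1 i).mul
      (tendsto_inv_atTop_zero.comp (tendsto_log_iterate_atTop (i + 1)))
    rw [mul_zero] at h
    refine h.congr' ?_
    filter_upwards [eventually_gt_atTop 0,
      (tendsto_log_iterate_atTop (i + 1)).eventually (eventually_ge_atTop 1)] with L hL h1
    simp only [Function.comp_apply]
    field_simp

theorem eventually_sum_layerSize_le (hε0 : 0 < ε) (hε1 : ε < 1) (M d : ℝ) :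
    ∀ᶠ L in atTop, ∑ i ∈ Finset.range (k + 1),
      (layerSize k ε L (i + 1) * (M + Real.log^[i + 1] L) + d * layerSize k ε L i) ≤
        (1 - ε / 2) * L := by
  have h : Tendsto (fun L : ℝ => ∑ i ∈ Finset.range (k + 1),
      (M * (layerSize k ε L (i + 1) / L) + layerSize k ε L (i + 1) * Real.log^[i + 1] L / L +
        d * (layerSize k ε L i / L))) atTop (𝓝 (∑ i ∈ Finset.range (k + 1),
          (M * 0 + (if i = k then 1 - ε else 0) + d * 0))) :=
    tendsto_finsetSum _ fun i _ => (((tendsto_layerSize_div hε1 (i + 1)).const_mul M).add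
      (tendsto_layerSize_succ_mul_div hε1 i)).add ((tendsto_layerSize_div hε1 i).const_mul d)
  have hs : ∑ i ∈ Finset.range (k + 1), (M * 0 + (if i = k then 1 - ε else 0) + d * 0) =
      1 - ε := by
    simp
  rw [hs] at h
  filter_upwards [h.eventually (gt_mem_nhds (by linarith : 1 - ε < 1 - ε / 2)),
    eventually_gt_atTop 0] with L h1 hL
  refine le_trans (le_of_eq ?_) (mul_le_mul_of_nonneg_right h1.le hL.le)
  rw [Finset.sum_mul]
  refine Finset.sum_congr rfl fun i _ => ?_
  field_simp

end layerSize

/-! ### Asymptotics of the lower bound -/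

theorem exp_neg_two_mul_le_one_sub {x : ℝ} (h0 : 0 ≤ x) (h1 : x ≤ 1 / 2) :
    Real.exp (-(2 * x)) ≤ 1 - x := by
  rw [Real.exp_neg, inv_le_comm₀ (Real.exp_pos _) (by linarith)]
  refine le_trans ?_ (Real.add_one_le_exp (2 * x))
  rw [inv_le_iff_one_le_mul₀ (by linarith)]
  -- Indeed `(1 - x) * (1 + 2 * x) = 1 + x * (1 - 2 * x) ≥ 1`.
  nlinarith

namespace SimpleGraph

/-- From `u ≥ n / 8`, `p = c / n` and `b ≤ 2 * H * a` one gets `u * a * p / b ≥ c / (16 * H)`; the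
power of `1 - p` is at least `exp (-2 * p * a * n) = exp (-2 * c * a)`. -/
theorem exp_neg_le_layer_factor {c H p u : ℝ} {n a b : ℕ} (hc : 0 < c) (hH : 1 ≤ H) (ha : 1 ≤ a)
    (hb : 1 ≤ b) (hn : 0 < n) (hp : p = c / n) (hp2 : p ≤ 1 / 2) (hu : (n : ℝ) / 8 ≤ u)
    (hba : (b : ℝ) ≤ 2 * H * a) :
    Real.exp (-(b * (Real.log (16 / c) + Real.log H) + 2 * c * a)) ≤
      (u * a * p / b) ^ b * (1 - p) ^ (a * n) := by
  have hn0 : (0 : ℝ) < n := by exact_mod_cast hn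
  have ha0 : (0 : ℝ) < a := by exact_mod_cast ha
  have hb0 : (0 : ℝ) < b := by exact_mod_cast hb
  have hp0 : 0 ≤ p := by rw [hp]; positivity
  have h1 : Real.exp (-(Real.log (16 / c) + Real.log H)) ≤ u * a * p / b := by
    rw [← Real.log_mul (by positivity) (by positivity), Real.exp_neg, Real.exp_log (by positivity),
      le_div_iff₀ hb0]
    calc (16 / c * H)⁻¹ * b ≤ (16 / c * H)⁻¹ * (2 * H * a) := by gcongr
      _ = n / 8 * a * p := by rw [hp]; field_simp; norm_num
      _ ≤ u * a * p := by gcongr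
  have h2 : Real.exp (-(2 * c * a)) ≤ (1 - p) ^ (a * n) := by
    calc Real.exp (-(2 * c * a)) = Real.exp (-(2 * p)) ^ (a * n) := by
          rw [← Real.exp_nat_mul, hp]
          push_cast
          field_simp
      _ ≤ _ := pow_le_pow_left₀ (Real.exp_pos _).le (exp_neg_two_mul_le_one_sub hp0 hp2) _
  rw [neg_add, Real.exp_add, ← mul_neg, Real.exp_nat_mul]
  exact mul_le_mul (pow_le_pow_left₀ (Real.exp_pos _).le h1 _) h2 (Real.exp_pos _).le
    (pow_nonneg ((Real.exp_pos _).le.trans h1) _)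

theorem tendsto_binomialRandom_forall_card_ballIn_le {c : ℝ} (hc : 0 < c) (k : ℕ)
    {p : ℕ → unitInterval} (hp : ∀ᶠ n : ℕ in atTop, (p n : ℝ) = c / n) {ε : ℝ} (hε0 : 0 < ε)
    (hε1 : ε < 1) :
    Tendsto (fun n : ℕ => (binomialRandom (Fin n) (p n)).real
      {G | ∀ v, (G.ballIn Finset.univ (k + 1) {v}).card ≤
        layerSize k ε (Real.log n) (k + 1)}) atTop (𝓝 0) := by
  have hlogn : Tendsto (fun n : ℕ => Real.log n) atTop atTop :=
    Real.tendsto_log_atTop.comp tendsto_natCast_atTop_atTop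
  have hlog0 : Tendsto (fun n : ℕ => Real.log n / n) atTop (𝓝 0) := by
    exact Real.isLittleO_log_id_atTop.tendsto_div_nhds_zero.comp tendsto_natCast_atTop_atTop
  have hpn0 : Tendsto (fun n : ℕ => c / (n : ℝ)) atTop (𝓝 0) :=
    tendsto_const_nhds.div_atTop tendsto_natCast_atTop_atTop
  have hlim : Tendsto (fun n : ℕ => Real.exp (-(1 / 8 * (Real.exp (ε / 2 * Real.log n) /
      Real.log n ^ (1 : ℝ))))) atTop (𝓝 0) :=
    Real.tendsto_exp_neg_atTop_nhds_zero.comp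
      (((tendsto_exp_mul_div_rpow_atTop 1 (ε / 2) (by positivity)).comp hlogn).const_mul_atTop
        (by norm_num))
  have hsum : ∀ᶠ L : ℝ in atTop, ∑ i ∈ Finset.range (k + 1), (layerSize k ε L (i + 1) : ℝ) ≤ L := by
    have h := tendsto_finsetSum (Finset.range (k + 1)) fun i _ =>
      tendsto_layerSize_div (k := k) hε1 (i + 1)
    rw [Finset.sum_const_zero] at h
    filter_upwards [h.eventually (gt_mem_nhds one_pos), eventually_gt_atTop 0] with L h1 hL
    rw [← Finset.sum_div, div_lt_one hL] at h1
    exact h1.le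
  have hratio : ∀ᶠ L : ℝ in atTop, ∀ i ∈ Finset.range (k + 1),
      (layerSize k ε L (i + 1) : ℝ) ≤ 2 * Real.log^[i] L * layerSize k ε L i ∧
      1 ≤ Real.log^[i] L ∧ 1 ≤ layerSize k ε L i ∧ 1 ≤ layerSize k ε L (i + 1) := by
    rw [eventually_all_finset]
    intro i hi
    exact (layerSize_succ_le hε0 hε1 (Nat.lt_succ_iff.1 (Finset.mem_range.1 hi))).and
      (((tendsto_log_iterate_atTop i).eventually (eventually_ge_atTop 1)).and
        ((one_le_layerSize hε1 i).and (one_le_layerSize hε1 (i + 1))))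
  refine tendsto_of_tendsto_of_tendsto_of_le_of_le' tendsto_const_nhds hlim
    (Eventually.of_forall fun n => measureReal_nonneg) ?_
  filter_upwards [hp, hlogn.eventually hsum, hlogn.eventually hratio,
    hlogn.eventually (eventually_sum_layerSize_le (k := k) hε0 hε1 (Real.log (16 / c)) (2 * c)),
    hlog0.eventually (gt_mem_nhds (by norm_num : (0 : ℝ) < 1 / 16)),
    hpn0.eventually (gt_mem_nhds (by norm_num : (0 : ℝ) < 1 / 2)),
    hlogn.eventually (eventually_ge_atTop 1), eventually_ge_atTop 64]
    with n hpn hsum hratio hcost hlogn hp2 hlog1 hn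
  set L := Real.log n with hL
  set a := layerSize k ε L with ha
  have hn64 : (64 : ℝ) ≤ n := by exact_mod_cast hn
  have hn0 : (0 : ℝ) < n := by linarith
  rw [div_lt_iff₀ hn0] at hlogn
  have hlast : 1 ≤ a (k + 1) := (hratio k (by simp)).2.2.2
  have hlastL : (a (k + 1) : ℝ) ≤ L :=
    (Finset.single_le_sum (f := fun i => (a (i + 1) : ℝ)) (fun i _ => Nat.cast_nonneg _)
      (Finset.self_mem_range_succ k)).trans hsum
  have hu : (n : ℝ) / 8 ≤ (n / 4 : ℕ) := by
    have : n ≤ (n / 4) * 8 := by omega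
    rw [div_le_iff₀ (by norm_num)]
    exact_mod_cast this
  -- With this many attempts at most `n / 4` vertices are used up, leaving room for the reserve `u =
  -- n / 4` and for the layers, whose total is at most `n / 16`.
  set j := n / (4 * a (k + 1)) with hj
  have hjmul : j * a (k + 1) ≤ n / 4 := by
    rw [Nat.le_div_iff_mul_le (by norm_num), mul_assoc, mul_comm (a (k + 1))]
    exact Nat.div_mul_le_self _ _
  have hjge : (n : ℝ) / (8 * L) ≤ j := by
    have h1 : (n : ℝ) < (j + 1) * (4 * a (k + 1)) := by
      exact_mod_cast (Nat.div_lt_iff_lt_mul (by omega)).1 (Nat.lt_succ_self j)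
    have h2 : (n : ℝ) < (j + 1) * (4 * L) := h1.trans_le (by gcongr)
    rw [div_le_iff₀ (by linarith)]
    nlinarith
  have htotal : n / 4 + ∑ i ∈ Finset.range (k + 1), a (i + 1) + 1 + j * a (k + 1) ≤
      Fintype.card (Fin n) := by
    have h1 : ((∑ i ∈ Finset.range (k + 1), a (i + 1) : ℕ) : ℝ) * 16 ≤ n := by
      push_cast
      linarith
    have h2 : (∑ i ∈ Finset.range (k + 1), a (i + 1)) * 16 ≤ n := by exact_mod_cast h1
    rw [Fintype.card_fin]
    omega
  refine (binomialRandom_real_forall_card_ballIn_univ_le_le (p n) a (by simp [ha, layerSize])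
    htotal).trans (Real.exp_le_exp.2 (neg_le_neg ?_))
  have hq : Real.exp (-((1 - ε / 2) * L)) ≤ ∏ i ∈ Finset.range (k + 1),
      (((n / 4 : ℕ) * a i * p n / a (i + 1) : ℝ) ^ a (i + 1) *
        (1 - p n : ℝ) ^ (a i * Fintype.card (Fin n))) := by
    refine (Real.exp_le_exp.2 (neg_le_neg hcost)).trans ?_
    rw [← Finset.sum_neg_distrib, Real.exp_sum]
    refine Finset.prod_le_prod (fun _ _ => (Real.exp_pos _).le) fun i hi => ?_
    obtain ⟨h1, h2, h3, h4⟩ := hratio i hi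
    rw [Function.iterate_succ_apply', Fintype.card_fin]
    exact exp_neg_le_layer_factor hc h2 h3 h4 (by omega) hpn (hpn ▸ hp2.le) hu h1
  -- The expected number of successes is at least `n / (8 * L) * n ^ (-1 + ε / 2)`, which is `n ^ (ε
  -- / 2) / (8 * L)`.
  refine le_trans (le_of_eq ?_) (mul_le_mul hjge hq (Real.exp_pos _).le (Nat.cast_nonneg _))
  have hnL : (n : ℝ) = Real.exp L := (Real.exp_log hn0).symm
  have hexp : Real.exp (ε / 2 * L) = Real.exp L * Real.exp (-((1 - ε / 2) * L)) := by
    rw [← Real.exp_add]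
    ring_nf
  rw [Real.rpow_one, hnL, hexp]
  field_simp

end SimpleGraph

/-! ### Combining the two bounds -/

/-- The edge probabilities are `p n = c / n` as soon as `n` is large (for `n < c` the number
`c / n` is not a probability). -/
theorem theorem1 (c : ℝ) (hc : 0 < c) (r : ℕ) (hr : 2 ≤ r) (p : ℕ → unitInterval)
    (hp : ∀ᶠ n : ℕ in atTop, (p n : ℝ) = c / n) :
    AsympEqWHP (fun n => SimpleGraph.binomialRandom (Fin n) (p n))
      (fun n G => ((G.power r).maxDegree : ℝ))
      (fun n => Real.log n / iteratedLog (r + 1) n) := by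
  intro ε hε
  obtain ⟨k, rfl⟩ : ∃ k, r = k + 1 := ⟨r - 1, by omega⟩
  -- The layer construction needs a parameter below 1; a smaller parameter gives a stronger lower
  -- bound.
  set δ := min ε (1 / 2) with hδ
  have hδ0 : 0 < δ := lt_min hε (by norm_num)
  have hδ1 : δ < 1 := (min_le_right _ _).trans_lt (by norm_num)
  have hupper := SimpleGraph.tendsto_binomialRandom_exists_le_card_ballIn hc k hp hε
  have hlower := SimpleGraph.tendsto_binomialRandom_forall_card_ballIn_le hc k hp hδ0 hδ1
  have hH : Tendsto (fun n : ℕ => iteratedLog (k + 1 + 1) n) atTop atTop :=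
    (tendsto_log_iterate_atTop (k + 2)).comp tendsto_natCast_atTop_atTop
  have hlim := (tendsto_const_nhds (x := (1 : ℝ))).sub (hupper.add hlower)
  rw [add_zero, sub_zero] at hlim
  suffices h : Tendsto (fun n : ℕ => (SimpleGraph.binomialRandom (Fin n) (p n)).real
      {G | (1 - ε) * (Real.log n / iteratedLog (k + 1 + 1) n) ≤ ((G.power (k + 1)).maxDegree : ℝ) ∧
        ((G.power (k + 1)).maxDegree : ℝ) ≤
          (1 + ε) * (Real.log n / iteratedLog (k + 1 + 1) n)}) atTop (𝓝 1) by
    have h2 := ENNReal.tendsto_ofReal h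
    rw [ENNReal.ofReal_one] at h2
    exact h2.congr fun _ => ofReal_measureReal
  refine tendsto_of_tendsto_of_tendsto_of_le_of_le' hlim tendsto_const_nhds ?_
    (Eventually.of_forall fun n => measureReal_le_one)
  filter_upwards [hH.eventually (eventually_gt_atTop 0), eventually_ge_atTop 1] with n hHn hn
  have hf : 0 ≤ Real.log n / iteratedLog (k + 1 + 1) n :=
    div_nonneg (Real.log_nonneg (by exact_mod_cast hn)) hHn.le
  have : NeZero n := ⟨by omega⟩
  rw [sub_le_iff_le_add]
  refine (probReal_univ (μ := SimpleGraph.binomialRandom (Fin n) (p n))).ge.trans ?_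
  -- Every graph is in the good event, has a ball that is too large, or has only balls that are too
  -- small.
  refine (measureReal_mono (fun G _ => ?_) (measure_ne_top _ _)).trans
    ((measureReal_union_le _ _).trans (add_le_add le_rfl (measureReal_union_le _ _)))
  by_contra hG
  simp only [Set.mem_union, Set.mem_ofPred_eq, not_or, not_exists, not_forall, not_le] at hG
  obtain ⟨h1, h2, v, h3⟩ := hG
  refine h1 ⟨?_, ?_⟩
  · have h4 : layerSize k δ (Real.log n) (k + 1) ≤ (G.power (k + 1)).maxDegree := by
      refine le_trans ?_ ((G.power (k + 1)).degree_le_maxDegree v)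
      rw [SimpleGraph.card_ballIn_univ] at h3
      omega
    have h5 : Real.log n / iteratedLog (k + 1 + 1) n * (1 - δ) ≤
        layerSize k δ (Real.log n) (k + 1) := by
      rw [layerSize, if_neg (Nat.succ_ne_zero k), layerFactor, if_pos rfl]
      exact Nat.le_ceil _
    have h6 : (1 - ε) * (Real.log n / iteratedLog (k + 1 + 1) n) ≤
        (1 - δ) * (Real.log n / iteratedLog (k + 1 + 1) n) :=
      mul_le_mul_of_nonneg_right (by linarith [min_le_left ε (1 / 2)]) hf
    have h7 : (layerSize k δ (Real.log n) (k + 1) : ℝ) ≤ (G.power (k + 1)).maxDegree := by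
      exact_mod_cast h4
    linarith
  · obtain ⟨w, hw⟩ := (G.power (k + 1)).exists_maximal_degree_vertex
    have h4 := (h2 w).le
    rw [SimpleGraph.card_ballIn_univ, ← hw] at h4
    push_cast at h4
    linarith
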